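/- An integer $a$ is called regular (mod $n$) if there is an integer $x$ such that $a^2x\equiv a \pmod n$. For $n\ge 1$ let $\varrho(n)$ denote the number of integers $a$ with $1\le a\le n$ that are regular (mod $n$), let $\phi$ be Euler's totient function, let $\log$ be the natural logarithm, and let $\gamma$ be the Euler–Mascheroni constant. Then \[ \limsup_{n\to\infty} \frac{\varrho(n)}{\phi(n)\log\log n}=e^{\gamma}. \] -/

import Mathlib

/-- An integer `a` is regular (mod `n`) if `a ^ 2 * x ≡ a (mod n)` for some integer `x`. -/
def IsRegularMod (n : ℕ) (a : ℤ) : Prop :=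
  ∃ x : ℤ, a ^ 2 * x ≡ a [ZMOD (n : ℤ)]

open Classical in
/-- The set of integers `a` with `1 ≤ a ≤ n` that are regular (mod `n`). -/
noncomputable def regularSet (n : ℕ) : Finset ℕ :=
  (Finset.Icc 1 n).filter (fun a => IsRegularMod n (a : ℤ))

/-- The number of regular integers `a` (mod `n`) with `1 ≤ a ≤ n`. -/
noncomputable def regularCount (n : ℕ) : ℕ :=
  (regularSet n).card

/-! Always `regularCount n ≤ n`, with equality for squarefree `n`, so the problem reduces to the
maximal order of `n / φ(n) = ∏ (1 - 1/p)⁻¹` over `p ∣ n`. For the upper bound, primes above `log n`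
contribute `o(1)` to the logarithm of this product (`sum_primeFactors_neg_log_le`), and the primes
up to `log n` are handled by Mertens' third theorem. The bound is attained along primorials, which
are squarefree and, by Chebyshev, satisfy `log log (primorial m) ≤ log m + O(1)`.

Most of the work is Mertens' third theorem. Legendre's formula and partial summation give `∑ 1/p =
log log n + M + o(1)`. Comparing Laplace transforms of this sum and of the harmonic numbers,
together with `ζ(1 + ε) ~ 1/ε`, gives `M + ∑ (-log (1 - 1/p) - 1/p) = γ`
(`mertens_constant_add_tsum_eq`). -/

open Filter Topology MeasureTheory

/-! ### Factorials and Mertens' first theorem -/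

theorem Nat.Prime.div_le_factorization_factorial {p : ℕ} (hp : p.Prime) (n : ℕ) :
    n / p ≤ (n.factorial).factorization p := by
  rw [Nat.factorization_factorial hp (b := Nat.log p n + 2) (by omega)]
  calc n / p = n / p ^ 1 := by rw [pow_one]
    _ ≤ ∑ i ∈ Finset.Ico 1 (Nat.log p n + 2), n / p ^ i :=
      Finset.single_le_sum (f := fun i => n / p ^ i) (fun _ _ => Nat.zero_le _) (by simp)

theorem Nat.Prime.sub_one_mul_factorization_factorial_le {p : ℕ} (hp : p.Prime) (n : ℕ) :
    (p - 1) * (n.factorial).factorization p ≤ n := by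
  rw [Nat.sub_one_mul_factorization_factorial hp]
  exact Nat.sub_le _ _

theorem Real.log_factorial_eq_sum_primesLE (n : ℕ) :
    Real.log (n.factorial : ℝ) =
      ∑ p ∈ Nat.primesLE n, ((n.factorial).factorization p : ℝ) * Real.log p := by
  rw [Real.log_nat_eq_sum_factorization, Finsupp.sum]
  refine Finset.sum_subset (fun p hp => ?_) (fun p _ hp => ?_)
  · rw [Nat.support_factorization, Nat.mem_primeFactors] at hp
    exact Nat.mem_primesLE.2 ⟨(hp.1.dvd_factorial).1 hp.2.1, hp.1⟩
  · rw [Finsupp.notMem_support_iff] at hp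
    simp [hp]

theorem Real.log_factorial_le_mul_log (n : ℕ) :
    Real.log (n.factorial : ℝ) ≤ n * Real.log n := by
  rw [← Real.log_pow]
  refine Real.log_le_log (by exact_mod_cast Nat.factorial_pos n) ?_
  exact_mod_cast Nat.factorial_le_pow n

theorem Real.mul_log_sub_le_log_factorial {n : ℕ} (hn : 1 ≤ n) :
    n * Real.log n - n ≤ Real.log (n.factorial : ℝ) := by
  have h := Stirling.le_log_factorial_stirling (n := n) (by omega)
  have h1 : 0 ≤ Real.log n := Real.log_natCast_nonneg n
  have h2 : 0 ≤ Real.log (2 * Real.pi) := Real.log_nonneg (by nlinarith [Real.pi_gt_three])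
  linarith

/-- Controls the higher prime powers in Legendre's formula, since `1/(p-1) - 1/p = 1/(p(p-1))`. -/
theorem summable_log_div_mul_sub_one :
    Summable (fun k : ℕ => Real.log k / (k * (k - 1) : ℝ)) := by
  have hs : Summable (fun k : ℕ => 4 * (1 / (k : ℝ) ^ (3 / 2 : ℝ))) :=
    (Real.summable_one_div_nat_rpow.2 (by norm_num)).mul_left 4
  refine hs.of_norm_bounded (fun k => ?_)
  rcases Nat.lt_or_ge k 2 with hk | hk
  · interval_cases k <;> simp
  have hk' : (2 : ℝ) ≤ k := by exact_mod_cast hk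
  have hk0 : (0 : ℝ) < k := by linarith
  have hlog : Real.log k ≤ (k : ℝ) ^ (1 / 2 : ℝ) / (1 / 2) :=
    Real.log_le_rpow_div hk0.le (by norm_num)
  have hl0 : 0 ≤ Real.log k := Real.log_natCast_nonneg k
  have hsq : (k : ℝ) ^ (1 / 2 : ℝ) * (k : ℝ) ^ (3 / 2 : ℝ) = k ^ 2 := by
    rw [← Real.rpow_add hk0, ← Real.rpow_natCast]; norm_num
  have h32 : 0 < (k : ℝ) ^ (3 / 2 : ℝ) := Real.rpow_pos_of_pos hk0 _
  rw [Real.norm_of_nonneg (div_nonneg hl0 (by nlinarith)), mul_one_div,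
    div_le_div_iff₀ (by nlinarith) h32]
  calc Real.log k * (k : ℝ) ^ (3 / 2 : ℝ)
      ≤ (k : ℝ) ^ (1 / 2 : ℝ) / (1 / 2) * (k : ℝ) ^ (3 / 2 : ℝ) := by gcongr
    _ = 2 * k ^ 2 := by rw [← hsq]; ring
    _ ≤ 4 * (k * (k - 1)) := by nlinarith

/-- **Mertens' first theorem**. -/
theorem exists_abs_sum_log_div_sub_log_le :
    ∃ C : ℝ, ∀ n : ℕ, 1 ≤ n →
      |∑ p ∈ Nat.primesLE n, Real.log p / p - Real.log n| ≤ C := by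
  set K : ℝ := ∑' k : ℕ, Real.log k / (k * (k - 1) : ℝ) with hK
  have hterm : ∀ k : ℕ, 0 ≤ Real.log k / (k * (k - 1) : ℝ) := by
    intro k
    rcases Nat.eq_zero_or_pos k with rfl | hk
    · simp
    have : (1 : ℝ) ≤ k := by exact_mod_cast hk
    exact div_nonneg (Real.log_natCast_nonneg k) (by nlinarith)
  have hK0 : 0 ≤ K := tsum_nonneg hterm
  refine ⟨1 + K + Real.log 4, fun n hn => ?_⟩
  have hn0 : (0 : ℝ) < n := by exact_mod_cast hn
  have hl4 : 0 ≤ Real.log 4 := Real.log_nonneg (by norm_num)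
  set A := ∑ p ∈ Nat.primesLE n, Real.log p / p with hA
  have hlow : n * A - Real.log 4 * n ≤ Real.log (n.factorial : ℝ) := by
    have hθ := Chebyshev.theta_le_log4_mul_x (x := (n : ℝ)) hn0.le
    rw [Chebyshev.theta_eq_sum_primesLE_log] at hθ
    have : n * A - ∑ p ∈ Nat.primesLE n, Real.log p ≤ Real.log (n.factorial : ℝ) := by
      rw [Real.log_factorial_eq_sum_primesLE, hA, Finset.mul_sum, ← Finset.sum_sub_distrib]
      refine Finset.sum_le_sum (fun p hp => ?_)
      have hpp := Nat.prime_of_mem_primesLE hp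
      have h1 : (n : ℝ) / p - 1 ≤ ((n.factorial).factorization p : ℝ) := by
        have h2 : ((n / p : ℕ) : ℝ) ≤ ((n.factorial).factorization p : ℝ) := by
          exact_mod_cast hpp.div_le_factorization_factorial n
        have h3 : (n : ℝ) / p < (n / p : ℕ) + 1 := by
          rw [← Nat.floor_div_eq_div (K := ℝ)]
          exact Nat.lt_floor_add_one _
        linarith
      calc n * (Real.log p / p) - Real.log p = ((n : ℝ) / p - 1) * Real.log p := by ring
        _ ≤ _ := mul_le_mul_of_nonneg_right h1 (Real.log_natCast_nonneg p)
    linarith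
  have hup : Real.log (n.factorial : ℝ) ≤ n * A + n * K := by
    have h1 : ∑ p ∈ Nat.primesLE n, Real.log p / (p * (p - 1) : ℝ) ≤ K :=
      summable_log_div_mul_sub_one.sum_le_tsum _ (fun k _ => hterm k)
    have h2 : Real.log (n.factorial : ℝ) ≤
        n * A + n * ∑ p ∈ Nat.primesLE n, Real.log p / (p * (p - 1) : ℝ) := by
      rw [Real.log_factorial_eq_sum_primesLE, hA, ← mul_add, ← Finset.sum_add_distrib,
        Finset.mul_sum]
      refine Finset.sum_le_sum (fun p hp => ?_)
      have hpp := Nat.prime_of_mem_primesLE hp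
      have hp1 : (1 : ℝ) < p := by exact_mod_cast hpp.one_lt
      have h3 : ((p : ℝ) - 1) * ((n.factorial).factorization p : ℝ) ≤ n := by
        have := hpp.sub_one_mul_factorization_factorial_le n
        have h4 : (((p - 1) * (n.factorial).factorization p : ℕ) : ℝ) ≤ n := by
          exact_mod_cast this
        rwa [Nat.cast_mul, Nat.cast_sub hpp.one_le, Nat.cast_one] at h4
      have h5 : ((n.factorial).factorization p : ℝ) ≤ n / (p - 1) := by
        rw [le_div_iff₀ (by linarith)]; linarith
      calc ((n.factorial).factorization p : ℝ) * Real.log p ≤ n / (p - 1) * Real.log p :=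
            mul_le_mul_of_nonneg_right h5 (Real.log_natCast_nonneg p)
        _ = _ := by
          have : (p : ℝ) - 1 ≠ 0 := by linarith
          field_simp
          ring
    nlinarith
  have h1 := Real.log_factorial_le_mul_log n
  have h2 := Real.mul_log_sub_le_log_factorial hn
  rw [abs_le]
  constructor
  · have : n * (Real.log n - 1) ≤ n * (A + K) := by linarith
    have := le_of_mul_le_mul_left this hn0
    linarith
  · have : n * (A - Real.log 4) ≤ n * Real.log n := by linarith
    have := le_of_mul_le_mul_left this hn0
    linarith

/-! ### Mertens' second theorem -/

theorem Real.log_log_add_one_sub_le {x : ℝ} (hx : 1 < x) :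
    Real.log (Real.log (x + 1)) - Real.log (Real.log x) ≤ 1 / (x * Real.log x) := by
  have hl : 0 < Real.log x := Real.log_pos hx
  have hl' : 0 < Real.log (x + 1) := Real.log_pos (by linarith)
  rw [← Real.log_div hl'.ne' hl.ne']
  have h1 : Real.log (x + 1) - Real.log x ≤ 1 / x := by
    rw [← Real.log_div (by linarith) (by linarith)]
    refine (Real.log_le_sub_one_of_pos (by positivity)).trans (le_of_eq ?_)
    field_simp
    ring
  calc Real.log (Real.log (x + 1) / Real.log x) ≤ Real.log (x + 1) / Real.log x - 1 :=
        Real.log_le_sub_one_of_pos (by positivity)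
    _ = (Real.log (x + 1) - Real.log x) / Real.log x := by field_simp
    _ ≤ (1 / x) / Real.log x := by gcongr
    _ = 1 / (x * Real.log x) := by rw [div_div]

theorem Real.one_div_mul_log_le {x : ℝ} (hx : 1 < x) :
    1 / ((x + 1) * Real.log (x + 1)) ≤
      Real.log (Real.log (x + 1)) - Real.log (Real.log x) := by
  have hl : 0 < Real.log x := Real.log_pos hx
  have hl' : 0 < Real.log (x + 1) := Real.log_pos (by linarith)
  have h1 : 1 / (x + 1) ≤ Real.log (x + 1) - Real.log x := by
    have h := Real.log_le_sub_one_of_pos (x := x / (x + 1)) (by positivity)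
    rw [Real.log_div (by linarith) (by linarith)] at h
    have : x / (x + 1) - 1 = -(1 / (x + 1)) := by field_simp; ring
    linarith
  have h2 := Real.log_le_sub_one_of_pos (x := Real.log x / Real.log (x + 1)) (by positivity)
  rw [Real.log_div hl.ne' hl'.ne'] at h2
  have h3 : 1 / ((x + 1) * Real.log (x + 1)) ≤
      (Real.log (x + 1) - Real.log x) / Real.log (x + 1) := by
    rw [← div_div]; gcongr
  have h4 : (Real.log (x + 1) - Real.log x) / Real.log (x + 1) =
      1 - Real.log x / Real.log (x + 1) := by field_simp
  linarith

theorem exists_tendsto_sum_one_div_mul_log_sub_log_log :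
    ∃ L : ℝ, Tendsto (fun n : ℕ =>
      ∑ i ∈ Finset.range n, 1 / (((i : ℝ) + 2) * Real.log ((i : ℝ) + 2)) -
        Real.log (Real.log ((n : ℝ) + 2))) atTop (𝓝 L) := by
  set s : ℕ → ℝ := fun n => ∑ i ∈ Finset.range n, 1 / (((i : ℝ) + 2) * Real.log ((i : ℝ) + 2))
    with hs
  have hmono : Monotone (fun n : ℕ => s n - Real.log (Real.log ((n : ℝ) + 2))) := by
    refine monotone_nat_of_le_succ (fun n => ?_)
    have h := Real.log_log_add_one_sub_le (x := (n : ℝ) + 2) (by linarith [n.cast_nonneg (α := ℝ)])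
    have e : ((n + 1 : ℕ) : ℝ) + 2 = (n : ℝ) + 2 + 1 := by push_cast; ring
    simp only [hs, Finset.sum_range_succ, e]
    linarith
  -- Taking one more term makes the difference decrease, so its initial value bounds the increasing
  -- sequence.
  have hanti : Antitone (fun n : ℕ => s (n + 1) - Real.log (Real.log ((n : ℝ) + 2))) := by
    refine antitone_nat_of_succ_le (fun n => ?_)
    have h := Real.one_div_mul_log_le (x := (n : ℝ) + 2) (by linarith [n.cast_nonneg (α := ℝ)])
    have e : ((n + 1 : ℕ) : ℝ) + 2 = (n : ℝ) + 2 + 1 := by push_cast; ring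
    simp only [hs, Finset.sum_range_succ _ (n + 1), e]
    linarith
  refine ⟨_, tendsto_atTop_ciSup hmono ⟨s 1 - Real.log (Real.log 2), ?_⟩⟩
  rintro _ ⟨n, rfl⟩
  have h1 := hanti (Nat.zero_le n)
  have h2 : s n ≤ s (n + 1) := by
    simp only [hs, Finset.sum_range_succ]
    have : 0 ≤ Real.log ((n : ℝ) + 2) :=
      Real.log_nonneg (by have : (0 : ℝ) ≤ n := n.cast_nonneg
                          linarith)
    have : 0 ≤ 1 / (((n : ℝ) + 2) * Real.log ((n : ℝ) + 2)) := by positivity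
    linarith
  simp only [Nat.cast_zero, zero_add] at h1
  linarith

theorem sum_primesLE_succ_eq_sum_range (f : ℕ → ℝ) (n : ℕ) :
    ∑ p ∈ Nat.primesLE (n + 1), f p =
      ∑ i ∈ Finset.range n, if (i + 2).Prime then f (i + 2) else 0 := by
  rw [Nat.primesLE_eq_filter_range, Finset.sum_filter, Finset.sum_range_succ', Finset.sum_range_succ']
  simp [Nat.not_prime_zero, Nat.not_prime_one]

/-- **Mertens' second theorem**, with an unspecified constant. -/
theorem exists_tendsto_sum_one_div_prime_sub_log_log :
    ∃ M : ℝ, Tendsto (fun n : ℕ =>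
      ∑ p ∈ Nat.primesLE n, 1 / (p : ℝ) - Real.log (Real.log n)) atTop (𝓝 M) := by
  obtain ⟨C, hC⟩ := exists_abs_sum_log_div_sub_log_le
  obtain ⟨L, hL⟩ := exists_tendsto_sum_one_div_mul_log_sub_log_log
  set f : ℕ → ℝ := fun i => 1 / Real.log ((i : ℝ) + 2) with hf
  set z : ℕ → ℝ := fun i =>
    (if (i + 2).Prime then Real.log ((i + 2 : ℕ) : ℝ) / ((i + 2 : ℕ) : ℝ) else 0) -
      1 / ((i : ℝ) + 2) with hz
  have hlogpos : ∀ i : ℕ, 0 < Real.log ((i : ℝ) + 2) := fun i =>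
    Real.log_pos (by have : (0 : ℝ) ≤ i := i.cast_nonneg
                     linarith)
  have htop : Tendsto (fun i : ℕ => (i : ℝ) + 2) atTop atTop :=
    tendsto_atTop_add_const_right _ _ tendsto_natCast_atTop_atTop
  have hfa : Antitone f := by
    intro i j hij
    have : (i : ℝ) ≤ j := by exact_mod_cast hij
    have h0 : (0 : ℝ) ≤ i := i.cast_nonneg
    exact one_div_le_one_div_of_le (hlogpos i) (Real.log_le_log (by linarith) (by linarith))
  have hf0 : Tendsto f atTop (𝓝 0) := by
    simp only [hf, one_div]
    exact (Real.tendsto_log_atTop.comp htop).inv_tendsto_atTop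
  -- Mertens' first theorem and the harmonic sum share the main term `log (n + 1)`, leaving a
  -- bounded difference; Dirichlet's test with weights `1 / log` then applies.
  have hzb : ∀ n, ‖∑ i ∈ Finset.range n, z i‖ ≤ C + 1 := by
    intro n
    have h1 := hC (n + 1) (by omega)
    have h2 : ∑ i ∈ Finset.range n, 1 / ((i : ℝ) + 2) = (harmonic (n + 1) : ℝ) - 1 := by
      rw [harmonic, Finset.sum_range_succ']
      push_cast
      simp only [inv_one, add_sub_cancel_right]
      refine Finset.sum_congr rfl (fun i _ => ?_)
      rw [one_div, add_assoc]; norm_num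
    have h3 : Real.log ((n + 1 : ℕ) : ℝ) ≤ harmonic (n + 1) :=
      (Real.log_le_log (by positivity) (by push_cast; linarith)).trans (log_add_one_le_harmonic (n + 1))
    have h4 : (harmonic (n + 1) : ℝ) ≤ 1 + Real.log ((n + 1 : ℕ) : ℝ) := harmonic_le_one_add_log _
    rw [sum_primesLE_succ_eq_sum_range (fun p => Real.log p / p)] at h1
    rw [hz, Finset.sum_sub_distrib, h2, Real.norm_eq_abs, abs_le]
    rw [abs_le] at h1
    constructor <;> linarith [h1.1, h1.2]
  obtain ⟨R, hR⟩ := cauchySeq_tendsto_of_complete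
    (hfa.cauchySeq_series_mul_of_tendsto_zero_of_bounded hf0 hzb)
  -- The `n` terms cover the integers `2, …, n + 1`, whereas the comparison sum is normalised at `n
  -- + 2`.
  have hgap : Tendsto (fun n : ℕ => Real.log (Real.log ((n : ℝ) + 2)) -
      Real.log (Real.log ((n + 1 : ℕ) : ℝ))) atTop (𝓝 0) := by
    have hup : Tendsto (fun n : ℕ => 1 / (((n + 1 : ℕ) : ℝ) * Real.log ((n + 1 : ℕ) : ℝ))) atTop
        (𝓝 0) := by
      have h1 : Tendsto (fun x : ℝ => 1 / (x * Real.log x)) atTop (𝓝 0) := by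
        simp only [one_div]
        exact (tendsto_id.atTop_mul_atTop₀ Real.tendsto_log_atTop).inv_tendsto_atTop
      exact h1.comp (tendsto_natCast_atTop_atTop.comp (tendsto_add_atTop_nat 1))
    refine tendsto_of_tendsto_of_tendsto_of_le_of_le' tendsto_const_nhds hup ?_ ?_
    · filter_upwards [eventually_ge_atTop 1] with n hn
      have hn' : (1 : ℝ) ≤ n := by exact_mod_cast hn
      have h1 : 0 < Real.log ((n + 1 : ℕ) : ℝ) := Real.log_pos (by push_cast; linarith)
      refine sub_nonneg.2 (Real.log_le_log h1 (Real.log_le_log (by positivity) ?_))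
      push_cast; linarith
    · filter_upwards [eventually_ge_atTop 1] with n hn
      have hn' : (1 : ℝ) ≤ n := by exact_mod_cast hn
      have h := Real.log_log_add_one_sub_le (x := ((n + 1 : ℕ) : ℝ)) (by push_cast; linarith)
      have e : ((n + 1 : ℕ) : ℝ) + 1 = (n : ℝ) + 2 := by push_cast; ring
      rwa [e] at h
  refine ⟨R + L + 0, (tendsto_add_atTop_iff_nat 1).1 (((hR.add hL).add hgap).congr (fun n => ?_))⟩
  rw [sum_primesLE_succ_eq_sum_range (fun p => 1 / (p : ℝ))]
  have : ∑ i ∈ Finset.range n, (if (i + 2).Prime then 1 / ((i + 2 : ℕ) : ℝ) else 0) =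
      ∑ i ∈ Finset.range n, f i • z i +
        ∑ i ∈ Finset.range n, 1 / (((i : ℝ) + 2) * Real.log ((i : ℝ) + 2)) := by
    rw [← Finset.sum_add_distrib]
    refine Finset.sum_congr rfl (fun i _ => ?_)
    have h1 := (hlogpos i).ne'
    have h2 : (i : ℝ) + 2 ≠ 0 := by positivity
    simp only [hf, hz, smul_eq_mul]
    push_cast
    split_ifs <;> field_simp <;> ring
  rw [this]
  ring

/-! ### Laplace transforms of summatory functions -/

/-- Write `exp (-c n)` as the integral of `exp (-v)` over `v ≥ c n` and exchange sum and integral: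
Abel summation without derivatives. -/
theorem hasSum_mul_exp_neg_integral {a c : ℕ → ℝ} (hc : ∀ n, 0 ≤ c n)
    (hs : Summable fun n => |a n| * Real.exp (-c n)) :
    HasSum (fun n => a n * Real.exp (-c n))
      (∫ v in Set.Ioi (0 : ℝ), ∑' n, if c n ≤ v then Real.exp (-v) * a n else 0) := by
  have key : ∀ (b : ℝ) (n : ℕ), ∫ v in Set.Ioi (0 : ℝ),
      (if c n ≤ v then Real.exp (-v) * b else 0) = b * Real.exp (-c n) := by
    intro b n
    have h1 : (fun v : ℝ => if c n ≤ v then Real.exp (-v) * b else 0) =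
        (Set.Ici (c n)).indicator (fun v => Real.exp (-v) * b) := by
      ext v; simp [Set.indicator_apply]
    rw [h1, ← integral_Ici_eq_integral_Ioi, setIntegral_indicator measurableSet_Ici,
      Set.inter_eq_right.2 (Set.Ici_subset_Ici.2 (hc n)), integral_Ici_eq_integral_Ioi,
      integral_mul_const, integral_exp_neg_Ioi, mul_comm]
  have hint : ∀ n, Integrable (fun v : ℝ => if c n ≤ v then Real.exp (-v) * a n else 0)
      (volume.restrict (Set.Ioi 0)) := by
    intro n
    have h1 : (fun v : ℝ => if c n ≤ v then Real.exp (-v) * a n else 0) =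
        (Set.Ici (c n)).indicator (fun v => Real.exp (-v) * a n) := by
      ext v; simp [Set.indicator_apply]
    rw [h1]
    have h2 : IntegrableOn (fun v : ℝ => Real.exp (-v)) (Set.Ioi 0) := by
      simpa using integrableOn_exp_neg_Ioi 0
    exact (Integrable.mul_const h2 (a n)).indicator measurableSet_Ici
  have h := hasSum_integral_of_summable_integral_norm hint ?_
  · simpa only [key] using h
  · have h3 : ∀ n, ∫ v in Set.Ioi (0 : ℝ), ‖(if c n ≤ v then Real.exp (-v) * a n else 0 : ℝ)‖ =
        |a n| * Real.exp (-c n) := by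
      intro n
      rw [← key |a n| n]
      congr 1; ext v
      split_ifs
      · rw [norm_mul, Real.norm_eq_abs, Real.norm_eq_abs, Real.abs_exp]
      · simp
    simpa only [h3] using hs

/-- An Abelian theorem: for fixed `v > 0`, `v / ε → ∞`, and `B * exp (-v)` dominates. -/
theorem tendsto_integral_exp_neg_mul_div {D : ℝ → ℝ} (hD : Measurable D) {B L : ℝ}
    (hB : ∀ u, 0 ≤ u → |D u| ≤ B) (hL : Tendsto D atTop (𝓝 L)) :
    Tendsto (fun ε : ℝ => ∫ v in Set.Ioi (0 : ℝ), Real.exp (-v) * D (v / ε)) (𝓝[>] 0) (𝓝 L) := by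
  have hexp : IntegrableOn (fun v : ℝ => Real.exp (-v)) (Set.Ioi 0) := by
    simpa using integrableOn_exp_neg_Ioi 0
  have h1 : ∫ v in Set.Ioi (0 : ℝ), Real.exp (-v) * L = L := by
    rw [integral_mul_const, integral_exp_neg_Ioi_zero, one_mul]
  rw [← h1]
  refine tendsto_integral_filter_of_dominated_convergence (fun v => Real.exp (-v) * B) ?_ ?_ ?_ ?_
  · refine Eventually.of_forall (fun ε => ?_)
    exact ((Real.measurable_exp.comp measurable_neg).mul
      (hD.comp (measurable_id.div_const ε))).aestronglyMeasurable
  · filter_upwards [self_mem_nhdsWithin] with ε hε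
    filter_upwards [ae_restrict_mem measurableSet_Ioi] with v hv
    rw [norm_mul, Real.norm_eq_abs, Real.norm_eq_abs, Real.abs_exp]
    have : 0 < v / ε := div_pos hv hε
    exact mul_le_mul_of_nonneg_left (hB _ this.le) (Real.exp_pos _).le
  · exact Integrable.mul_const hexp B
  · filter_upwards [ae_restrict_mem measurableSet_Ioi] with v hv
    refine (hL.comp ?_).const_mul _
    exact (tendsto_inv_nhdsGT_zero.const_mul_atTop hv).congr (fun ε => (div_eq_mul_inv v ε).symm)

theorem tendsto_log_floor_sub_log :
    Tendsto (fun x : ℝ => Real.log (⌊x⌋₊ : ℝ) - Real.log x) atTop (𝓝 0) := by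
  have h := (Real.continuousAt_log one_ne_zero).tendsto.comp (tendsto_nat_floor_div_atTop (R := ℝ))
  rw [Real.log_one] at h
  refine h.congr' ?_
  filter_upwards [eventually_ge_atTop 1] with x hx
  have : (0 : ℝ) < ⌊x⌋₊ := by exact_mod_cast Nat.floor_pos.2 hx
  exact Real.log_div this.ne' (by linarith)

theorem tendsto_log_log_floor_exp_sub_log :
    Tendsto (fun u : ℝ => Real.log (Real.log (⌊Real.exp u⌋₊ : ℝ)) - Real.log u) atTop (𝓝 0) := by
  have h1 : Tendsto (fun u : ℝ => (Real.log (⌊Real.exp u⌋₊ : ℝ) - u) * u⁻¹ + 1) atTop (𝓝 1) := by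
    have h2 := tendsto_log_floor_sub_log.comp Real.tendsto_exp_atTop
    have h3 : Tendsto (fun u : ℝ => Real.log (⌊Real.exp u⌋₊ : ℝ) - u) atTop (𝓝 0) :=
      h2.congr (fun u => by simp)
    simpa using (h3.mul tendsto_inv_atTop_zero).add_const 1
  have h := (Real.continuousAt_log one_ne_zero).tendsto.comp h1
  rw [Real.log_one] at h
  refine h.congr' ?_
  filter_upwards [eventually_ge_atTop 1] with u hu
  have h4 : (2 : ℝ) ≤ Real.exp u := by linarith [Real.add_one_le_exp u]
  have h5 : 2 ≤ ⌊Real.exp u⌋₊ := Nat.le_floor (by exact_mod_cast h4)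
  have h6 : 0 < Real.log (⌊Real.exp u⌋₊ : ℝ) := Real.log_pos (by exact_mod_cast h5)
  rw [← Real.log_div h6.ne' (by linarith)]
  simp only [Function.comp]
  congr 1
  field_simp
  ring

/-- The sum of `1 / p` over the primes `p ≤ exp u` minus the harmonic sum up to `u`. -/
noncomputable def primeHarmonicGap (u : ℝ) : ℝ :=
  ∑ p ∈ Nat.primesLE ⌊Real.exp u⌋₊, 1 / (p : ℝ) - (harmonic ⌊u⌋₊ : ℝ)

theorem measurable_primeHarmonicGap : Measurable primeHarmonicGap := by
  refine Measurable.sub ?_ ?_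
  · exact (measurable_from_nat (f := fun n : ℕ => ∑ p ∈ Nat.primesLE n, 1 / (p : ℝ))).comp
      (Nat.measurable_floor.comp Real.measurable_exp)
  · exact (measurable_from_nat (f := fun n : ℕ => (harmonic n : ℝ))).comp Nat.measurable_floor

theorem tendsto_primeHarmonicGap {M : ℝ} (hM : Tendsto (fun n : ℕ =>
      ∑ p ∈ Nat.primesLE n, 1 / (p : ℝ) - Real.log (Real.log n)) atTop (𝓝 M)) :
    Tendsto primeHarmonicGap atTop (𝓝 (M - Real.eulerMascheroniConstant)) := by
  have h1 := hM.comp (tendsto_nat_floor_atTop.comp Real.tendsto_exp_atTop)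
  have h2 := Real.tendsto_harmonic_sub_log.comp (tendsto_nat_floor_atTop (α := ℝ))
  have h := ((h1.add tendsto_log_log_floor_exp_sub_log).sub h2).sub tendsto_log_floor_sub_log
  simp only [add_zero, sub_zero] at h
  refine h.congr (fun u => ?_)
  simp only [Function.comp, primeHarmonicGap]
  ring

/-- Convergence bounds the gap beyond some `T`; below `T` both sums are at most their values at `T`.
-/
theorem abs_primeHarmonicGap_le {M : ℝ} (hM : Tendsto (fun n : ℕ =>
      ∑ p ∈ Nat.primesLE n, 1 / (p : ℝ) - Real.log (Real.log n)) atTop (𝓝 M)) :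
    ∃ B, ∀ u, 0 ≤ u → |primeHarmonicGap u| ≤ B := by
  have h := (tendsto_primeHarmonicGap hM).abs.eventually_le_const (lt_add_one _)
  obtain ⟨T, hT⟩ := eventually_atTop.1 h
  refine ⟨max (|M - Real.eulerMascheroniConstant| + 1)
    (∑ p ∈ Nat.primesLE ⌊Real.exp T⌋₊, 1 / (p : ℝ) + (harmonic ⌊T⌋₊ : ℝ)), fun u _ => ?_⟩
  rcases le_total T u with hu | hu
  · exact (hT u hu).trans (le_max_left _ _)
  · refine le_trans ?_ (le_max_right _ _)
    have h1 : ∑ p ∈ Nat.primesLE ⌊Real.exp u⌋₊, 1 / (p : ℝ) ≤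
        ∑ p ∈ Nat.primesLE ⌊Real.exp T⌋₊, 1 / (p : ℝ) :=
      Finset.sum_le_sum_of_subset_of_nonneg
        (Nat.primesLE_mono (Nat.floor_mono (Real.exp_le_exp.2 hu))) (fun _ _ _ => by positivity)
    have h2 : (harmonic ⌊u⌋₊ : ℝ) ≤ harmonic ⌊T⌋₊ := by
      have : harmonic ⌊u⌋₊ ≤ harmonic ⌊T⌋₊ :=
        Finset.sum_le_sum_of_subset_of_nonneg
          (Finset.range_mono (Nat.floor_mono hu)) (fun _ _ _ => by positivity)
      exact_mod_cast this
    have h3 : 0 ≤ ∑ p ∈ Nat.primesLE ⌊Real.exp u⌋₊, 1 / (p : ℝ) :=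
      Finset.sum_nonneg (fun _ _ => by positivity)
    have h4 : (0 : ℝ) ≤ harmonic ⌊u⌋₊ := by
      have : 0 ≤ harmonic ⌊u⌋₊ := Finset.sum_nonneg (fun _ _ => by positivity)
      exact_mod_cast this
    rw [primeHarmonicGap, abs_le]
    constructor <;> linarith

/-- The value `n ^ (-1 - ε)` at primes `n`, and `0` elsewhere. -/
noncomputable def primeTerm (ε : ℝ) (n : ℕ) : ℝ :=
  (if n.Prime then 1 / (n : ℝ) else 0) * Real.exp (-(ε * Real.log n))

theorem primeTerm_eq_rpow {ε : ℝ} {n : ℕ} (hn : n.Prime) :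
    primeTerm ε n = (n : ℝ) ^ (-(1 + ε)) := by
  have h0 : (0 : ℝ) < n := by exact_mod_cast hn.pos
  rw [primeTerm, if_pos hn, Real.rpow_def_of_pos h0, one_div, ← Real.exp_log (inv_pos.2 h0),
    ← Real.exp_add, Real.log_inv]
  congr 1
  ring

theorem primeTerm_of_not_prime {ε : ℝ} {n : ℕ} (hn : ¬ n.Prime) : primeTerm ε n = 0 := by
  simp [primeTerm, hn]

theorem primeTerm_nonneg (ε : ℝ) (n : ℕ) : 0 ≤ primeTerm ε n := by
  unfold primeTerm; split_ifs <;> positivity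

theorem summable_primeTerm {ε : ℝ} (hε : 0 < ε) : Summable (primeTerm ε) := by
  refine (Real.summable_nat_rpow (p := -(1 + ε)).2 (by linarith)).of_norm_bounded (fun n => ?_)
  rw [Real.norm_of_nonneg (primeTerm_nonneg _ _)]
  by_cases hn : n.Prime
  · rw [primeTerm_eq_rpow hn]
  · rw [primeTerm_of_not_prime hn]; positivity

theorem tsum_primeTerm_eq_integral {ε : ℝ} (hε : 0 < ε) :
    ∑' n, primeTerm ε n = ∫ v in Set.Ioi (0 : ℝ), Real.exp (-v) *
      ∑ p ∈ Nat.primesLE ⌊Real.exp (v / ε)⌋₊, 1 / (p : ℝ) := by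
  have hs := summable_primeTerm hε
  have h := hasSum_mul_exp_neg_integral (a := fun n => if n.Prime then 1 / (n : ℝ) else 0)
    (c := fun n => ε * Real.log n) (fun n => mul_nonneg hε.le (Real.log_natCast_nonneg n))
    (hs.congr (fun n => by
      rw [primeTerm, abs_of_nonneg]; split_ifs <;> positivity))
  refine (h.tsum_eq).trans (setIntegral_congr_fun measurableSet_Ioi (fun v _ => ?_))
  rw [tsum_eq_sum (s := Nat.primesLE ⌊Real.exp (v / ε)⌋₊), Finset.mul_sum]
  · refine Finset.sum_congr rfl (fun p hp => ?_)
    obtain ⟨h1, h2⟩ := Nat.mem_primesLE.1 hp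
    have h0 : (0 : ℝ) < p := by exact_mod_cast h2.pos
    have h3 : (p : ℝ) ≤ Real.exp (v / ε) := (Nat.le_floor_iff (Real.exp_pos _).le).1 h1
    have h4 := (Real.log_le_iff_le_exp h0).2 h3
    rw [le_div_iff₀ hε] at h4
    rw [if_pos (by linarith), if_pos h2]
  · intro n hn
    by_cases hp : n.Prime
    · rw [if_neg]
      intro h1
      refine hn (Nat.mem_primesLE.2 ⟨Nat.le_floor ?_, hp⟩)
      rw [← Real.log_le_iff_le_exp (by exact_mod_cast hp.pos), le_div_iff₀ hε]
      linarith
    · simp [hp]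

theorem hasSum_exp_neg_mul_div {ε : ℝ} (hε : 0 < ε) :
    HasSum (fun n : ℕ => 1 / ((n : ℝ) + 1) * Real.exp (-(ε * ((n : ℝ) + 1))))
      (-Real.log (1 - Real.exp (-ε))) := by
  have h := Real.hasSum_pow_div_log_of_abs_lt_one (x := Real.exp (-ε))
    (by rw [Real.abs_exp, Real.exp_lt_one_iff]; linarith)
  refine h.congr_fun (fun n => ?_)
  rw [← Real.exp_nat_mul]
  push_cast
  rw [show -(ε * ((n : ℝ) + 1)) = ((n : ℝ) + 1) * -ε by ring]
  ring

theorem neg_log_one_sub_exp_neg_eq_integral {ε : ℝ} (hε : 0 < ε) :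
    -Real.log (1 - Real.exp (-ε)) =
      ∫ v in Set.Ioi (0 : ℝ), Real.exp (-v) * (harmonic ⌊v / ε⌋₊ : ℝ) := by
  have hs := hasSum_exp_neg_mul_div hε
  have h := hasSum_mul_exp_neg_integral (a := fun n => 1 / ((n : ℝ) + 1))
    (c := fun n => ε * ((n : ℝ) + 1)) (fun n => by positivity)
    (hs.summable.congr (fun n => by rw [abs_of_nonneg (by positivity)]))
  refine (hs.unique h).trans (setIntegral_congr_fun measurableSet_Ioi (fun v hv => ?_))
  have hv0 : 0 ≤ v / ε := (div_pos hv hε).le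
  have hiff : ∀ n : ℕ, ε * ((n : ℝ) + 1) ≤ v ↔ n ∈ Finset.range ⌊v / ε⌋₊ := by
    intro n
    rw [Finset.mem_range, ← Nat.succ_le_iff, Nat.le_floor_iff hv0, le_div_iff₀ hε, mul_comm]
    push_cast
    rfl
  rw [tsum_eq_sum (s := Finset.range ⌊v / ε⌋₊), harmonic]
  · push_cast
    rw [Finset.mul_sum]
    refine Finset.sum_congr rfl (fun n hn => ?_)
    rw [if_pos ((hiff n).2 hn), one_div]
  · intro n hn
    rw [if_neg (fun h => hn ((hiff n).1 h))]

/-- Both terms are Laplace transforms at scale `1 / ε`, of the prime sum and (with a minus sign) of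
the harmonic numbers, so the Abelian theorem applies to the gap. This is where `γ` enters. -/
theorem tendsto_tsum_primeTerm_add_log {M : ℝ} (hM : Tendsto (fun n : ℕ =>
      ∑ p ∈ Nat.primesLE n, 1 / (p : ℝ) - Real.log (Real.log n)) atTop (𝓝 M)) :
    Tendsto (fun ε : ℝ => ∑' n, primeTerm ε n + Real.log (1 - Real.exp (-ε))) (𝓝[>] 0)
      (𝓝 (M - Real.eulerMascheroniConstant)) := by
  obtain ⟨B, hB⟩ := abs_primeHarmonicGap_le hM
  refine (tendsto_integral_exp_neg_mul_div measurable_primeHarmonicGap hB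
    (tendsto_primeHarmonicGap hM)).congr' ?_
  filter_upwards [self_mem_nhdsWithin] with ε hε
  have hε : 0 < ε := hε
  have e1 := tsum_primeTerm_eq_integral hε
  have e2 := neg_log_one_sub_exp_neg_eq_integral hε
  -- Positivity yields integrability: the Bochner integral of a non-integrable function is zero.
  have p1 : 0 < ∑' n, primeTerm ε n := by
    refine (summable_primeTerm hε).tsum_pos (primeTerm_nonneg ε) 2 ?_
    rw [primeTerm_eq_rpow Nat.prime_two]; positivity
  have p2 : 0 < -Real.log (1 - Real.exp (-ε)) := by
    rw [← (hasSum_exp_neg_mul_div hε).tsum_eq]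
    exact (hasSum_exp_neg_mul_div hε).summable.tsum_pos (fun n => by positivity) 0 (by positivity)
  have i1 := Integrable.of_integral_ne_zero (e1 ▸ p1.ne')
  have i2 := Integrable.of_integral_ne_zero (e2 ▸ p2.ne')
  rw [← sub_neg_eq_add, e1, e2, ← integral_sub i1 i2]
  refine setIntegral_congr_fun measurableSet_Ioi (fun v _ => ?_)
  simp only [primeHarmonicGap]
  ring

/-! ### The Euler product near `1` and Mertens' third theorem -/

theorem Real.neg_log_one_sub_sub_nonneg {x : ℝ} (hx : x < 1) : 0 ≤ -Real.log (1 - x) - x := by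
  have := Real.log_le_sub_one_of_pos (x := 1 - x) (by linarith)
  linarith

theorem Real.neg_log_one_sub_sub_le {x : ℝ} (hx : x ≤ 1 / 2) :
    -Real.log (1 - x) - x ≤ 2 * x ^ 2 := by
  have h := Real.one_sub_inv_le_log_of_pos (x := 1 - x) (by linarith)
  have h1 : (1 - x)⁻¹ ≤ 1 + x + 2 * x ^ 2 := by
    rw [inv_le_iff_one_le_mul₀ (by linarith)]
    nlinarith [mul_nonneg (sq_nonneg x) (by linarith : (0 : ℝ) ≤ 1 - 2 * x)]
  linarith

theorem primeTerm_le {ε : ℝ} (hε : 0 ≤ ε) (n : ℕ) : primeTerm ε n ≤ 1 / (n : ℝ) := by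
  have h1 : Real.exp (-(ε * Real.log n)) ≤ 1 :=
    Real.exp_le_one_iff.2 (by have := mul_nonneg hε (Real.log_natCast_nonneg n); linarith)
  rw [primeTerm]
  split_ifs
  · exact mul_le_of_le_one_right (by positivity) h1
  · simp

theorem primeTerm_le_half {ε : ℝ} (hε : 0 ≤ ε) (n : ℕ) : primeTerm ε n ≤ 1 / 2 := by
  by_cases hn : n.Prime
  · refine (primeTerm_le hε n).trans (one_div_le_one_div_of_le (by norm_num) ?_)
    exact_mod_cast hn.two_le
  · rw [primeTerm_of_not_prime hn]; norm_num

theorem norm_neg_log_one_sub_primeTerm_le {ε : ℝ} (hε : 0 ≤ ε) (n : ℕ) :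
    ‖-Real.log (1 - primeTerm ε n) - primeTerm ε n‖ ≤ 2 * (1 / (n : ℝ) ^ 2) := by
  have h := primeTerm_le_half hε n
  rw [Real.norm_of_nonneg (Real.neg_log_one_sub_sub_nonneg (by linarith))]
  refine (Real.neg_log_one_sub_sub_le h).trans ?_
  rw [← one_div_pow]
  gcongr
  · exact primeTerm_nonneg ε n
  · exact primeTerm_le hε n

theorem summable_two_mul_one_div_sq : Summable (fun n : ℕ => 2 * (1 / (n : ℝ) ^ 2)) :=
  (Real.summable_one_div_nat_pow.2 (by norm_num)).mul_left 2

theorem summable_neg_log_one_sub_primeTerm_sub {ε : ℝ} (hε : 0 ≤ ε) :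
    Summable (fun n => -Real.log (1 - primeTerm ε n) - primeTerm ε n) :=
  summable_two_mul_one_div_sq.of_norm_bounded (norm_neg_log_one_sub_primeTerm_le hε)

/-- With the linear term removed, the summands are dominated by `2 / n ^ 2` uniformly in `ε`, so the
limit can be taken termwise. -/
theorem tendsto_tsum_neg_log_one_sub_primeTerm_sub :
    Tendsto (fun ε : ℝ => ∑' n, (-Real.log (1 - primeTerm ε n) - primeTerm ε n)) (𝓝[>] 0)
      (𝓝 (∑' n, (-Real.log (1 - primeTerm 0 n) - primeTerm 0 n))) := by
  refine tendsto_tsum_of_dominated_convergence summable_two_mul_one_div_sq (fun n => ?_) ?_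
  · have h1 : Tendsto (fun ε => primeTerm ε n) (𝓝[>] 0) (𝓝 (primeTerm 0 n)) := by
      have : Continuous (fun ε => primeTerm ε n) := by unfold primeTerm; fun_prop
      exact this.continuousAt.tendsto.mono_left nhdsWithin_le_nhds
    have h2 := primeTerm_le_half le_rfl n
    exact ((h1.const_sub 1).log (by linarith)).neg.sub h1
  · filter_upwards [self_mem_nhdsWithin] with ε hε
    exact norm_neg_log_one_sub_primeTerm_le (le_of_lt hε)

theorem log_riemannZeta_eq_tsum_primeTerm {ε : ℝ} (hε : 0 < ε) :
    Real.log (riemannZeta ((1 + ε : ℝ) : ℂ)).re = ∑' n, -Real.log (1 - primeTerm ε n) := by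
  have h := riemannZeta_eulerProduct_exp_log (s := ((1 + ε : ℝ) : ℂ))
    (by rw [Complex.ofReal_re]; linarith)
  have h1 : ∀ p : Nat.Primes, -Complex.log (1 - (p : ℂ) ^ (-((1 + ε : ℝ) : ℂ))) =
      ((-Real.log (1 - primeTerm ε p) : ℝ) : ℂ) := by
    intro p
    have h2 := primeTerm_le_half hε.le p
    rw [Complex.ofReal_neg, Complex.ofReal_log (by linarith), primeTerm_eq_rpow p.2,
      Complex.ofReal_sub, Complex.ofReal_cpow (Nat.cast_nonneg _)]
    push_cast
    rfl
  simp only [h1] at h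
  rw [← Complex.ofReal_tsum] at h
  rw [← h, Complex.exp_ofReal_re, Real.log_exp]
  refine (tsum_subtype {p : ℕ | p.Prime} (fun n => -Real.log (1 - primeTerm ε n))).trans
    (tsum_congr (fun n => ?_))
  by_cases hn : n.Prime
  · exact Set.indicator_of_mem (s := {p : ℕ | p.Prime}) hn _
  · refine (Set.indicator_of_notMem (s := {p : ℕ | p.Prime}) hn _).trans ?_
    rw [primeTerm_of_not_prime hn]; simp

theorem tendsto_log_sub_log_one_sub_exp_neg :
    Tendsto (fun ε : ℝ => Real.log ε - Real.log (1 - Real.exp (-ε))) (𝓝[>] 0) (𝓝 0) := by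
  have h1 : HasDerivAt (fun ε : ℝ => 1 - Real.exp (-ε)) 1 0 := by
    have := ((hasDerivAt_neg (0 : ℝ)).exp).const_sub 1
    simpa using this
  have h2 : Tendsto (fun ε : ℝ => ε⁻¹ * (1 - Real.exp (-ε))) (𝓝[>] 0) (𝓝 1) := by
    have := h1.tendsto_slope_zero_right
    simpa using this
  have h3 := ((Real.continuousAt_log one_ne_zero).tendsto.comp h2).neg
  rw [Real.log_one, neg_zero] at h3
  refine h3.congr' ?_
  filter_upwards [self_mem_nhdsWithin] with ε hε
  have hε : 0 < ε := hε
  have h4 : Real.exp (-ε) < 1 := Real.exp_lt_one_iff.2 (by linarith)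
  simp only [Function.comp]
  rw [Real.log_mul (inv_pos.2 hε).ne' (by linarith), Real.log_inv]
  ring

/-- Evaluate the limit of `log ζ(1 + ε) + log ε` twice: the simple pole gives `0`, the Euler product
gives `M - γ` plus the second-order series. -/
theorem mertens_constant_add_tsum_eq {M : ℝ} (hM : Tendsto (fun n : ℕ =>
      ∑ p ∈ Nat.primesLE n, 1 / (p : ℝ) - Real.log (Real.log n)) atTop (𝓝 M)) :
    M + ∑' n, (-Real.log (1 - primeTerm 0 n) - primeTerm 0 n) =
      Real.eulerMascheroniConstant := by
  have h1 := ((tendsto_tsum_primeTerm_add_log hM).add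
    tendsto_tsum_neg_log_one_sub_primeTerm_sub).add tendsto_log_sub_log_one_sub_exp_neg
  have hshift : Tendsto (fun ε : ℝ => 1 + ε) (𝓝[>] 0) (𝓝[>] 1) := by
    refine tendsto_nhdsWithin_iff.2 ⟨?_, ?_⟩
    · have : Continuous (fun ε : ℝ => 1 + ε) := by fun_prop
      simpa using (this.tendsto 0).mono_left nhdsWithin_le_nhds
    · filter_upwards [self_mem_nhdsWithin] with ε hε
      have hε : 0 < ε := hε
      exact Set.mem_Ioi.2 (by linarith)
  have h2 := ((Asymptotics.isLittleO_one_iff ℝ).1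
    log_riemannZeta_add_log_sub_isLittleO_ofReal).comp hshift
  have h3 := tendsto_nhds_unique (h2.congr' ?_) h1
  · linarith
  filter_upwards [self_mem_nhdsWithin] with ε hε
  have hε : 0 < ε := hε
  have h4 := (summable_primeTerm hε).tsum_add (summable_neg_log_one_sub_primeTerm_sub hε.le)
  simp only [add_sub_cancel] at h4
  simp only [Function.comp]
  rw [log_riemannZeta_eq_tsum_primeTerm hε, h4, add_sub_cancel_left]
  ring

/-- **Mertens' third theorem**, in logarithmic form. -/
theorem tendsto_sum_neg_log_one_sub_inv_prime_sub_log_log :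
    Tendsto (fun n : ℕ => ∑ p ∈ Nat.primesLE n, -Real.log (1 - 1 / (p : ℝ)) -
      Real.log (Real.log n)) atTop (𝓝 Real.eulerMascheroniConstant) := by
  obtain ⟨M, hM⟩ := exists_tendsto_sum_one_div_prime_sub_log_log
  rw [← mertens_constant_add_tsum_eq hM]
  have h := ((summable_neg_log_one_sub_primeTerm_sub le_rfl).hasSum.tendsto_sum_nat).comp
    (tendsto_add_atTop_nat 1)
  refine (hM.add h).congr (fun n => ?_)
  have h1 : ∑ i ∈ Finset.range (n + 1), (-Real.log (1 - primeTerm 0 i) - primeTerm 0 i) =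
      ∑ p ∈ Nat.primesLE n, (-Real.log (1 - 1 / (p : ℝ)) - 1 / (p : ℝ)) := by
    rw [Nat.primesLE_eq_filter_range, Finset.sum_filter]
    refine Finset.sum_congr rfl (fun p _ => ?_)
    split_ifs with hp <;> simp [primeTerm, hp]
  simp only [Function.comp]
  rw [h1, Finset.sum_sub_distrib]
  ring

/-! ### Bounds for `n / φ(n)` -/

theorem neg_log_one_sub_one_div_nonneg {p : ℕ} (hp : p.Prime) :
    0 ≤ -Real.log (1 - 1 / (p : ℝ)) := by
  have hp2 : (2 : ℝ) ≤ p := by exact_mod_cast hp.two_le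
  have h1 : 1 / (p : ℝ) ≤ 1 / 2 := one_div_le_one_div_of_le (by norm_num) hp2
  have h2 : 0 < 1 / (p : ℝ) := by positivity
  have := Real.log_nonpos (x := 1 - 1 / (p : ℝ)) (by linarith) (by linarith)
  linarith

theorem neg_log_one_sub_one_div_le {p : ℕ} (hp : p.Prime) :
    -Real.log (1 - 1 / (p : ℝ)) ≤ 2 / p := by
  have hp2 : (2 : ℝ) ≤ p := by exact_mod_cast hp.two_le
  have h1 : 1 / (p : ℝ) ≤ 1 / 2 := one_div_le_one_div_of_le (by norm_num) hp2
  have h2 : 0 < 1 / (p : ℝ) := by positivity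
  have h3 := Real.neg_log_one_sub_sub_le h1
  have h4 : 2 / (p : ℝ) = 2 * (1 / p) := by ring
  nlinarith

theorem div_totient_eq_exp_sum {n : ℕ} (hn : n ≠ 0) :
    (n : ℝ) / Nat.totient n = Real.exp (∑ p ∈ n.primeFactors, -Real.log (1 - 1 / (p : ℝ))) := by
  have h1 : (Nat.totient n : ℝ) = n * ∏ p ∈ n.primeFactors, (1 - (p : ℝ)⁻¹) := by
    have := Nat.totient_eq_mul_prod_factors n
    have h := congrArg (fun q : ℚ => (q : ℝ)) this
    push_cast at h
    exact h
  have h2 : ∏ p ∈ n.primeFactors, (1 - (p : ℝ)⁻¹) =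
      Real.exp (∑ p ∈ n.primeFactors, Real.log (1 - 1 / (p : ℝ))) := by
    rw [Real.exp_sum]
    refine Finset.prod_congr rfl (fun p hp => ?_)
    have hp1 : (1 : ℝ) < p := by exact_mod_cast (Nat.prime_of_mem_primeFactors hp).one_lt
    rw [Real.exp_log, one_div]
    have := inv_lt_one_of_one_lt₀ hp1
    rw [one_div]; linarith
  have hn' : (n : ℝ) ≠ 0 := by exact_mod_cast hn
  rw [h1, h2, Finset.sum_neg_distrib, Real.exp_neg]
  field_simp

theorem sum_log_primeFactors_le_log {n : ℕ} (hn : n ≠ 0) :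
    ∑ p ∈ n.primeFactors, Real.log p ≤ Real.log n := by
  rw [← Real.log_prod (fun p hp => by
    exact_mod_cast (Nat.prime_of_mem_primeFactors hp).ne_zero), ← Nat.cast_prod]
  refine Real.log_le_log ?_ ?_
  · exact_mod_cast Finset.prod_pos (fun p hp => (Nat.prime_of_mem_primeFactors hp).pos)
  · exact_mod_cast Nat.le_of_dvd (Nat.pos_of_ne_zero hn) (Nat.prod_primeFactors_dvd n)

theorem sum_primeFactors_neg_log_le {n : ℕ} (hn : n ≠ 0) (hlog : 1 < Real.log n) :
    ∑ p ∈ n.primeFactors, -Real.log (1 - 1 / (p : ℝ)) ≤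
      ∑ p ∈ Nat.primesLE ⌊Real.log n⌋₊, -Real.log (1 - 1 / (p : ℝ)) +
        2 / Real.log (Real.log n) := by
  set y := Real.log n with hy
  have hly : 0 < Real.log y := Real.log_pos hlog
  have hy0 : 0 < y := by linarith
  rw [← Finset.sum_filter_add_sum_filter_not n.primeFactors (fun p => p ≤ ⌊y⌋₊)]
  refine add_le_add ?_ ?_
  · refine Finset.sum_le_sum_of_subset_of_nonneg (fun p hp => ?_) (fun p hp _ =>
      neg_log_one_sub_one_div_nonneg (Nat.prime_of_mem_primesLE hp))
    rw [Finset.mem_filter] at hp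
    exact Nat.mem_primesLE.2 ⟨hp.2, Nat.prime_of_mem_primeFactors hp.1⟩
  -- For `p > y` each term is at most `2 / y`; inserting the weight `log p / log y ≥ 1` allows `∑
  -- log p ≤ log n = y` to be used.
  · calc ∑ p ∈ n.primeFactors with ¬ p ≤ ⌊y⌋₊, -Real.log (1 - 1 / (p : ℝ))
        ≤ ∑ p ∈ n.primeFactors with ¬ p ≤ ⌊y⌋₊, 2 / (y * Real.log y) * Real.log p := by
          refine Finset.sum_le_sum (fun p hp => ?_)
          rw [Finset.mem_filter, not_le] at hp
          have hpp := Nat.prime_of_mem_primeFactors hp.1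
          have hyp : y < p := (Nat.floor_lt hy0.le).1 hp.2
          refine (neg_log_one_sub_one_div_le hpp).trans ?_
          calc 2 / (p : ℝ) ≤ 2 / y := by gcongr
            _ = 2 / (y * Real.log y) * Real.log y := by field_simp
            _ ≤ _ := by gcongr
      _ ≤ ∑ p ∈ n.primeFactors, 2 / (y * Real.log y) * Real.log p :=
          Finset.sum_le_sum_of_subset_of_nonneg (Finset.filter_subset _ _)
            (fun p _ _ => mul_nonneg (by positivity) (Real.log_natCast_nonneg p))
      _ ≤ 2 / (y * Real.log y) * y := by
          rw [← Finset.mul_sum]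
          exact mul_le_mul_of_nonneg_left (sum_log_primeFactors_le_log hn) (by positivity)
      _ = 2 / Real.log y := by field_simp

/-! ### Regular integers and the upper limit -/

theorem regularCount_le (n : ℕ) : regularCount n ≤ n := by
  classical
  refine (Finset.card_le_card (Finset.filter_subset _ (Finset.Icc 1 n))).trans ?_
  simp

/-- The congruence is linear in `x`, solvable once `gcd (a ^ 2) n ∣ a`; this gcd is squarefree and
divides `a ^ 2`. Bézout supplies `x`. -/
theorem Squarefree.isRegularMod {n : ℕ} (hn : Squarefree n) (a : ℕ) : IsRegularMod n a := by
  have hg : Nat.gcd (a ^ 2) n ∣ a :=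
    ((hn.squarefree_of_dvd (Nat.gcd_dvd_right _ _)).dvd_pow_iff_dvd two_ne_zero).1
      (Nat.gcd_dvd_left _ _)
  obtain ⟨k, hk⟩ := hg
  have hb := Nat.gcd_eq_gcd_ab (a ^ 2) n
  refine ⟨Nat.gcdA (a ^ 2) n * k, (Int.modEq_iff_dvd).2 ⟨Nat.gcdB (a ^ 2) n * k, ?_⟩⟩
  have hk' : (a : ℤ) = (Nat.gcd (a ^ 2) n : ℤ) * k := by exact_mod_cast hk
  push_cast at hb
  linear_combination hk' + (k : ℤ) * hb

theorem Squarefree.regularCount_eq {n : ℕ} (hn : Squarefree n) : regularCount n = n := by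
  classical
  have h : regularSet n = Finset.Icc 1 n := Finset.filter_true_of_mem (fun a _ => hn.isRegularMod a)
  rw [regularCount, h]
  simp

theorem tendsto_log_log_floor_sub_log_log :
    Tendsto (fun x : ℝ => Real.log (Real.log (⌊x⌋₊ : ℝ)) - Real.log (Real.log x)) atTop (𝓝 0) := by
  refine (tendsto_log_log_floor_exp_sub_log.comp Real.tendsto_log_atTop).congr' ?_
  filter_upwards [eventually_gt_atTop 0] with x hx
  simp only [Function.comp, Real.exp_log hx]

theorem tendsto_log_natCast : Tendsto (fun n : ℕ => Real.log n) atTop atTop :=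
  Real.tendsto_log_atTop.comp tendsto_natCast_atTop_atTop

theorem tendsto_log_log_natCast : Tendsto (fun n : ℕ => Real.log (Real.log n)) atTop atTop :=
  Real.tendsto_log_atTop.comp tendsto_log_natCast

theorem exists_tendsto_regularCount_div_le :
    ∃ v : ℕ → ℝ, Tendsto v atTop (𝓝 (Real.exp Real.eulerMascheroniConstant)) ∧
      ∀ᶠ n : ℕ in atTop, (regularCount n : ℝ) /
        ((Nat.totient n : ℝ) * Real.log (Real.log (n : ℝ))) ≤ v n := by
  have h1 := tendsto_sum_neg_log_one_sub_inv_prime_sub_log_log.comp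
    (tendsto_nat_floor_atTop.comp tendsto_log_natCast)
  have h2 := tendsto_log_log_floor_sub_log_log.comp tendsto_log_natCast
  have h3 : Tendsto (fun n : ℕ => 2 / Real.log (Real.log n)) atTop (𝓝 0) :=
    tendsto_log_log_natCast.const_div_atTop 2
  have h := (Real.continuous_exp.tendsto _).comp ((h1.add h2).add h3)
  rw [add_zero, add_zero] at h
  refine ⟨_, h, ?_⟩
  filter_upwards [eventually_ne_atTop 0, tendsto_log_natCast.eventually_gt_atTop 1,
    tendsto_log_log_natCast.eventually_gt_atTop 1] with n hn hlog hll
  have hφ : (0 : ℝ) < Nat.totient n := by exact_mod_cast Nat.totient_pos.2 (Nat.pos_of_ne_zero hn)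
  have hll0 : 0 < Real.log (Real.log n) := by linarith
  calc (regularCount n : ℝ) / ((Nat.totient n : ℝ) * Real.log (Real.log (n : ℝ)))
      ≤ (n : ℝ) / ((Nat.totient n : ℝ) * Real.log (Real.log (n : ℝ))) := by
        gcongr
        exact_mod_cast regularCount_le n
    _ = (n : ℝ) / Nat.totient n / Real.log (Real.log n) := by rw [div_div]
    _ ≤ Real.exp (∑ p ∈ Nat.primesLE ⌊Real.log n⌋₊, -Real.log (1 - 1 / (p : ℝ)) +
          2 / Real.log (Real.log n)) / Real.log (Real.log n) := by
        rw [div_totient_eq_exp_sum hn]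
        gcongr
        exact sum_primeFactors_neg_log_le hn hlog
    _ = Real.exp (∑ p ∈ Nat.primesLE ⌊Real.log n⌋₊, -Real.log (1 - 1 / (p : ℝ)) +
          2 / Real.log (Real.log n) - Real.log (Real.log (Real.log n))) := by
        rw [Real.exp_sub _ (Real.log (Real.log (Real.log n))), Real.exp_log hll0]
    _ = _ := by
        simp only [Function.comp]
        congr 1
        ring

theorem exists_tendsto_le_regularCount_primorial_div :
    ∃ v : ℕ → ℝ, Tendsto v atTop (𝓝 (Real.exp Real.eulerMascheroniConstant)) ∧
      ∀ᶠ m : ℕ in atTop, v m ≤ (regularCount (primorial m) : ℝ) /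
        ((Nat.totient (primorial m) : ℝ) * Real.log (Real.log (primorial m : ℝ))) := by
  have h1 := (Real.continuous_exp.tendsto _).comp
    tendsto_sum_neg_log_one_sub_inv_prime_sub_log_log
  have h2 : Tendsto (fun m : ℕ => 1 + Real.log (Real.log 4) / Real.log m) atTop (𝓝 1) := by
    simpa using (tendsto_log_natCast.const_div_atTop (Real.log (Real.log 4))).const_add 1
  have h := h1.div h2 one_ne_zero
  rw [div_one] at h
  refine ⟨_, h, ?_⟩
  filter_upwards [eventually_ne_atTop 0, tendsto_log_natCast.eventually_gt_atTop 1] with m hm hlog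
  have hm0 : (0 : ℝ) < m := by exact_mod_cast Nat.pos_of_ne_zero hm
  have hlog0 : 0 < Real.log m := by linarith
  have hmp : (m : ℝ) ≤ primorial m := by exact_mod_cast le_primorial_self
  have hlp : 1 < Real.log (primorial m) := hlog.trans_le (Real.log_le_log hm0 hmp)
  have hll : 0 < Real.log (Real.log (primorial m)) := Real.log_pos hlp
  have hl4 : 0 < Real.log 4 := Real.log_pos (by norm_num)
  -- Chebyshev's bound suffices without the prime number theorem: the constant `log 4` vanishes
  -- relative to `log m` after a second logarithm.
  have hθ : Real.log (primorial m) ≤ Real.log 4 * m := by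
    have h3 := Chebyshev.theta_le_log4_mul_x hm0.le
    rwa [Chebyshev.theta_eq_log_primorial, Nat.floor_natCast] at h3
  have hub : Real.log (Real.log (primorial m)) ≤
      Real.log m * (1 + Real.log (Real.log 4) / Real.log m) := by
    refine (Real.log_le_log (by linarith) hθ).trans (le_of_eq ?_)
    rw [Real.log_mul hl4.ne' hm0.ne']
    field_simp
    ring
  rw [(squarefree_primorial m).regularCount_eq, ← div_div,
    div_totient_eq_exp_sum (primorial_ne_zero m), primeFactors_primorial]
  simp only [Function.comp, Pi.div_apply]
  rw [Real.exp_sub, Real.exp_log hlog0, div_div]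
  gcongr

/- The upper limit is taken in the extended reals, so no boundedness is presupposed. -/
theorem theorem8 :
    Filter.limsup
      (fun n : ℕ =>
        (((regularCount n : ℝ) /
          ((Nat.totient n : ℝ) * Real.log (Real.log (n : ℝ))) : ℝ) : EReal))
      Filter.atTop
      = ((Real.exp Real.eulerMascheroniConstant : ℝ) : EReal) := by
  refine le_antisymm ?_ ?_
  · obtain ⟨v, hv, hle⟩ := exists_tendsto_regularCount_div_le
    rw [← (((continuous_coe_real_ereal.tendsto _).comp hv).limsup_eq)]
    refine limsup_le_limsup ?_
    filter_upwards [hle] with n hn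
    exact EReal.coe_le_coe_iff.2 hn
  · obtain ⟨v, hv, hle⟩ := exists_tendsto_le_regularCount_primorial_div
    rw [← (((continuous_coe_real_ereal.tendsto _).comp hv).limsup_eq)]
    have htop : Tendsto primorial atTop atTop :=
      tendsto_atTop_mono (fun _ => le_primorial_self) tendsto_id
    -- The upper limit along the primorials is at most the full one.
    refine le_trans (limsup_le_limsup ?_) (limsup_le_limsup_of_le htop)
    filter_upwards [hle] with m hm
    exact EReal.coe_le_coe_iff.2 hm
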